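/- Let $d\ge 1$. For a finite Borel measure $\mu$ on $\mathbb{R}^d$ put $H_{x,u}=\{y\in\mathbb{R}^d:\langle x,u\rangle\le\langle y,u\rangle\}$ for $x\in\mathbb{R}^d$ and $u$ in the unit sphere $\mathbb{S}^{d-1}$, and let $D(x;\mu)=\inf_{u\in\mathbb{S}^{d-1}}\mu(H_{x,u})$ be the halfspace depth, $D_\alpha(\mu)=\{x\in\mathbb{R}^d: D(x;\mu)\ge\alpha\}$ ($\alpha\in\mathbb{R}$) the depth regions, $\alpha^*(\mu)=\sup\{\alpha: D_\alpha(\mu)\neq\emptyset\}$, and $D_{\alpha^*(\mu)}(\mu)$ the set of medians of $\mu$. The measure $\mu$ is smooth at $x$ if $\mu(\partial H_{x,u})=0$ for all $u\in\mathbb{S}^{d-1}$, and smooth if it is smooth at every $x\in\mathbb{R}^d$. It has contiguous support if there is no slab $\{y: a<\langle y,u\rangle<b\}$ with $u\in\mathbb{S}^{d-1}$, $a<b$, of $\mu$-mass zero such that the support of $\mu$ meets both $\{y:\langle y,u\rangle\le a\}$ and $\{y:\langle y,u\rangle\ge b\}$. For $K,L\subset\mathbb{R}^d$ compact and non-empty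 let $$\delta(K,L)=\max\Big\{\sup_{x\in K}\inf_{y\in L}|x-y|,\ \sup_{x\in L}\inf_{y\in K}|x-y|\Big\}$$ be the Hausdorff distance, and put $\delta(K,L)=\infty$ if exactly one of $K,L$ is empty. (1) Let $\mu$ be a Borel probability measure on $\mathbb{R}^d$ with contiguous support that is smooth at some median of $\mu$. Let $X_1,X_2,\dots$ be independent random vectors with distribution $\mu$, defined on a probability space $(\Omega,\mathcal{A},\mathsf{P})$, and let $\widetilde{\mu_n}=\frac1n\sum_{i=1}^n\delta_{X_i}$ (with $\delta_{X_i}$ the Dirac measure at $X_i$) be the empirical measure of $X_1,\dots,X_n$. Then for every closed interval $A=[a,b]\subset(0,\alpha^*(\mu))$, $\mathsf{P}$-almost surely, $$\lim_{n\to\infty}\ \sup_{\alpha\in A}\ \delta\big(D_\alpha(\widetilde{\mu_n}),D_\alpha(\mu)\big)=0.$$ (2) Let $\mu$ be a finite Borel measure on $\mathbb{R}^d$ that is smooth and has contiguous support. Then for every closed interval $A=[a,b]\subset(0,\alpha^*(\mu))$ and every sequence $(\mu_n)$ of finite Borel measures on $\mathbb{R}^d$ converging weakly to $\mu$, $$\lim_{n\to\infty}\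 \sup_{\alpha\in A}\ \delta\big(D_\alpha(\mu_n),D_\alpha(\mu)\big)=0.$$ -/

import Mathlib

open MeasureTheory Filter Topology
open scoped ENNReal

noncomputable section

namespace HalfspaceDepth

/-- The closed halfspace `H_{x,u} = {y | ⟪x, u⟫ ≤ ⟪y, u⟫}`, with `x` in its boundary hyperplane and
inner normal `u`. It is used only for unit vectors `u`. -/
def halfspace {d : ℕ} (x u : EuclideanSpace ℝ (Fin d)) : Set (EuclideanSpace ℝ (Fin d)) :=
  {y | inner ℝ x u ≤ inner ℝ y u}

/-- The halfspace depth of the point `x` with respect to the (finite) measure `μ`: the infimum of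
`μ(H)` over the closed halfspaces `H` whose boundary passes through `x`. -/
def depth {d : ℕ} (μ : Measure (EuclideanSpace ℝ (Fin d))) (x : EuclideanSpace ℝ (Fin d)) : ℝ :=
  ⨅ u : Metric.sphere (0 : EuclideanSpace ℝ (Fin d)) 1, μ.real (halfspace x u)

/-- The depth region (central region) `D_α(μ)`. -/
def depthRegion {d : ℕ} (μ : Measure (EuclideanSpace ℝ (Fin d))) (α : ℝ) :
    Set (EuclideanSpace ℝ (Fin d)) :=
  {x | α ≤ depth μ x}

/-- The supremum `α^*(μ)` of all `α` for which `D_α(μ)` is non-empty. -/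
def maxDepth {d : ℕ} (μ : Measure (EuclideanSpace ℝ (Fin d))) : ℝ :=
  sSup {α : ℝ | (depthRegion μ α).Nonempty}

/-- The set of halfspace medians of `μ`. -/
def medianSet {d : ℕ} (μ : Measure (EuclideanSpace ℝ (Fin d))) :
    Set (EuclideanSpace ℝ (Fin d)) :=
  depthRegion μ (maxDepth μ)

/-- `μ` is smooth at the point `x`: the boundary of every closed halfspace whose boundary passes
through `x` is a `μ`-null set. -/
def IsSmoothAt {d : ℕ} (μ : Measure (EuclideanSpace ℝ (Fin d)))
    (x : EuclideanSpace ℝ (Fin d)) : Prop :=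
  ∀ u : EuclideanSpace ℝ (Fin d), ‖u‖ = 1 → μ (frontier (halfspace x u)) = 0

/-- `μ` is smooth: the boundary of every closed halfspace is a `μ`-null set. -/
def IsSmooth {d : ℕ} (μ : Measure (EuclideanSpace ℝ (Fin d))) : Prop :=
  ∀ x u : EuclideanSpace ℝ (Fin d), ‖u‖ = 1 → μ (frontier (halfspace x u)) = 0

/-- `μ` has contiguous support: no slab of positive width and zero `μ`-mass between two parallel
hyperplanes has points of the support of `μ` on both of its sides. -/
def HasContiguousSupport {d : ℕ} (μ : Measure (EuclideanSpace ℝ (Fin d))) : Prop :=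
  ∀ (u : EuclideanSpace ℝ (Fin d)) (a b : ℝ), ‖u‖ = 1 → a < b →
    μ {y | a < inner ℝ y u ∧ inner ℝ y u < b} = 0 →
    ¬((∃ y ∈ μ.support, inner ℝ y u ≤ a) ∧ (∃ z ∈ μ.support, b ≤ inner ℝ z u))

/-- The empirical measure of the first `n` terms of a sequence of points: mass `1 / n` at each
(the zero measure for `n = 0`). -/
def empiricalMeasure {d : ℕ} (x : ℕ → EuclideanSpace ℝ (Fin d)) (n : ℕ) :
    Measure (EuclideanSpace ℝ (Fin d)) :=
  (n : ℝ≥0∞)⁻¹ • ∑ i ∈ Finset.range n, Measure.dirac (x i)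

/-- The largest Hausdorff distance between `D_α(ν)` and `D_α(μ)` over `α ∈ A`. The distance takes
values in `[0, ∞]`; it is `∞` if exactly one of the two regions is empty. -/
def supHausdorffDist {d : ℕ} (ν μ : Measure (EuclideanSpace ℝ (Fin d))) (A : Set ℝ) : ℝ≥0∞ :=
  ⨆ α ∈ A, Metric.hausdorffEDist (depthRegion ν α) (depthRegion μ α)

end HalfspaceDepth

end

/-!
The proof reduces both parts to one statement: if `νₙ` converges weakly to a finite measure `μ` with
contiguous support that is smooth at *some* point `m` of depth greater than `b`, then the regions of
level in `[a, b]` converge uniformly in the Hausdorff distance (`tendsto_supHausdorffDist`). No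
uniform law of large numbers over halfspaces is needed, although `μ` may charge hyperplanes.

The reason is geometric (`lt_measureReal_openHalfspace`). Let `x ∈ D_α(μ)` with `α ≤ b`, and let
`y` lie strictly between `x` and `m`. Then every *open* halfspace bounded at `y` has mass greater
than `α`. Since mass of open sets is lower semicontinuous and the sphere of directions is compact,
`D(y; νₙ) ≥ α'` for all large `n` and all `α'` near `α` (`eventually_le_depth`). As `y` can be
chosen arbitrarily close to `x`, points of `D_α(μ)` are approximated by points of `D_α'(νₙ)`.
Conversely the depth is upper semicontinuous along weakly convergent sequences
(`eventually_depth_lt`), because closed halfspaces do not lose mass in the limit; so a point off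
`D_α(μ)` is eventually off `D_α'(νₙ)`, locally uniformly. Regions of positive level stay in a fixed
ball by tightness (`exists_radius`), and compactness of the ball times `[a, b]` makes these local
statements uniform (`eventually_forall_exists_dist_le`). That lemma treats two sequences with the
limit `μ`; taking one of them constant gives the two halves of the Hausdorff distance.

Under smoothness of `μ`, any `m` of depth greater than `b` will do. For empirical measures, weak
convergence holds almost surely by the strong law of large numbers
(`ae_portmanteauBounds_empiricalMeasure`).
-/

namespace HalfspaceDepth

variable {d : ℕ}

/-! ### Halfspaces and depth -/

/-- The open halfspace with `x` in its boundary hyperplane and inner normal `u`. -/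
def openHalfspace (x u : EuclideanSpace ℝ (Fin d)) : Set (EuclideanSpace ℝ (Fin d)) :=
  {y | inner ℝ x u < inner ℝ y u}

lemma isClosed_halfspace (x u : EuclideanSpace ℝ (Fin d)) : IsClosed (halfspace x u) :=
  isClosed_le (by fun_prop) (by fun_prop)

lemma frontier_halfspace (x : EuclideanSpace ℝ (Fin d)) {u : EuclideanSpace ℝ (Fin d)}
    (hu : ‖u‖ = 1) : frontier (halfspace x u) = {y | inner ℝ y u = inner ℝ x u} := by
  have hs : Function.Surjective (innerSL ℝ u) := fun c =>
    ⟨c • u, by simp [hu]⟩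
  have := (innerSL ℝ u).frontier_preimage hs (Set.Ici (inner ℝ x u))
  rw [frontier_Ici] at this
  have h1 : halfspace x u = innerSL ℝ u ⁻¹' Set.Ici (inner ℝ x u) := by
    ext y; simp [halfspace, real_inner_comm]
  rw [h1, this]
  ext y; simp [real_inner_comm]

lemma depth_le (μ : Measure (EuclideanSpace ℝ (Fin d))) (x : EuclideanSpace ℝ (Fin d))
    {u : EuclideanSpace ℝ (Fin d)} (hu : ‖u‖ = 1) : depth μ x ≤ μ.real (halfspace x u) :=
  ciInf_le (f := fun u : Metric.sphere (0 : EuclideanSpace ℝ (Fin d)) 1 => μ.real (halfspace x u))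
    ⟨0, by rintro _ ⟨v, rfl⟩; exact measureReal_nonneg⟩ ⟨u, by simp [hu]⟩

lemma nonempty_sphere [NeZero d] :
    Nonempty (Metric.sphere (0 : EuclideanSpace ℝ (Fin d)) 1) :=
  (NormedSpace.sphere_nonempty.2 zero_le_one).to_subtype

lemma le_depth [NeZero d] {μ : Measure (EuclideanSpace ℝ (Fin d))}
    {x : EuclideanSpace ℝ (Fin d)} {α : ℝ}
    (h : ∀ u : EuclideanSpace ℝ (Fin d), ‖u‖ = 1 → α ≤ μ.real (halfspace x u)) :
    α ≤ depth μ x :=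
  haveI := nonempty_sphere (d := d)
  le_ciInf fun u => h u (by simp)

lemma exists_measureReal_halfspace_lt [NeZero d] {μ : Measure (EuclideanSpace ℝ (Fin d))}
    {x : EuclideanSpace ℝ (Fin d)} {α : ℝ} (h : depth μ x < α) :
    ∃ u : EuclideanSpace ℝ (Fin d), ‖u‖ = 1 ∧ μ.real (halfspace x u) < α := by
  contrapose! h
  exact le_depth h

lemma exists_lt_depth_of_lt_maxDepth {μ : Measure (EuclideanSpace ℝ (Fin d))} {b : ℝ}
    (h : b < maxDepth μ) : ∃ m, b < depth μ m := by
  have hne : {α : ℝ | (depthRegion μ α).Nonempty}.Nonempty :=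
    ⟨depth μ 0, 0, le_refl (depth μ 0)⟩
  obtain ⟨α, ⟨m, hm⟩, hα⟩ := exists_lt_of_lt_csSup hne h
  exact ⟨m, lt_of_lt_of_le hα hm⟩

/-- Moving from a point `x` of `D_α(μ)` towards a point `m` of depth greater than `α` makes the mass
of every open halfspace bounded at the new point exceed `α`. Such a halfspace contains `H_{m,u}`, or
it is `H_{m,u}` up to a null set, or it contains `H_{x,u}` together with a slab that has positive
mass because the support is contiguous. -/
theorem lt_measureReal_openHalfspace {μ : Measure (EuclideanSpace ℝ (Fin d))} [IsFiniteMeasure μ]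
    (hμ : HasContiguousSupport μ) {x m u : EuclideanSpace ℝ (Fin d)} {α t : ℝ}
    (hm : IsSmoothAt μ m) (hα : 0 < α) (hx : α ≤ depth μ x) (hαm : α < depth μ m)
    (ht0 : 0 < t) (ht1 : t < 1) (hu : ‖u‖ = 1) :
    α < μ.real (openHalfspace (x + t • (m - x)) u) := by
  have hy : inner ℝ (x + t • (m - x)) u = inner ℝ x u + t * (inner ℝ m u - inner ℝ x u) := by
    simp [inner_add_left, inner_smul_left, inner_sub_left]
  have hmu := hαm.trans_le (depth_le μ m hu)
  have hxu := hx.trans (depth_le μ x hu)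
  rcases lt_trichotomy (inner ℝ x u) (inner ℝ m u) with h | h | h
  · refine hmu.trans_le (measureReal_mono fun z hz => ?_)
    simp only [halfspace, openHalfspace, Set.mem_ofPred_eq, hy] at hz ⊢
    nlinarith
  · refine hmu.trans_le ?_
    have hsub : halfspace m u ⊆ openHalfspace (x + t • (m - x)) u ∪ frontier (halfspace m u) := by
      intro z hz
      rw [frontier_halfspace m hu]
      simp only [halfspace, openHalfspace, Set.mem_ofPred_eq, Set.mem_union, hy, h] at hz ⊢
      rcases hz.lt_or_eq with h' | h'
      · left; linarith
      · right; exact h'.symm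
    calc μ.real (halfspace m u) ≤ _ := measureReal_mono hsub
      _ ≤ _ := measureReal_union_le _ _
      _ = _ := by simp [measureReal_def, hm u hu]
  · set s : Set (EuclideanSpace ℝ (Fin d)) :=
      {z | inner ℝ (x + t • (m - x)) u < inner ℝ z u ∧ inner ℝ z u < inner ℝ x u} with hs
    have hyx : inner ℝ (x + t • (m - x)) u < inner ℝ x u := by rw [hy]; nlinarith
    have hspos : μ s ≠ 0 := by
      intro h0
      have h1 : 0 < μ (halfspace m (-u)) := by
        have := (hα.trans hαm).trans_le (depth_le μ m (u := -u) (by simpa using hu))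
        exact (ENNReal.toReal_pos_iff.1 this).1
      have h2 : 0 < μ (halfspace x u) :=
        (ENNReal.toReal_pos_iff.1 (hα.trans_le hxu)).1
      obtain ⟨p, hp, hps⟩ := Measure.nonempty_inter_support_of_pos h1
      obtain ⟨q, hq, hqs⟩ := Measure.nonempty_inter_support_of_pos h2
      refine hμ u _ _ hu hyx h0 ⟨⟨p, hps, ?_⟩, ⟨q, hqs, hq⟩⟩
      simp only [halfspace, Set.mem_ofPred_eq, inner_neg_right, neg_le_neg_iff] at hp
      rw [hy]; nlinarith
    have hdisj : Disjoint s (halfspace x u) :=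
      Set.disjoint_left.2 fun z hz hz' => absurd hz.2 (not_lt.2 hz')
    have hsub : s ∪ halfspace x u ⊆ openHalfspace (x + t • (m - x)) u := by
      rintro z (hz | hz)
      · exact hz.1
      · exact hyx.trans_le hz
    have hsr : 0 < μ.real s := ENNReal.toReal_pos hspos (measure_ne_top _ _)
    have := measureReal_union (μ := μ) hdisj (isClosed_halfspace x u).measurableSet
    have := measureReal_mono (μ := μ) hsub
    linarith

/-! ### Sequences of measures with the portmanteau bounds -/

/-- Weak convergence of finite measures in portmanteau form: in the limit, open sets do not gain
mass and closed sets do not lose mass. The bounds are stated for individual thresholds `c`, which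
keeps them in `ℝ` and free of `liminf` and `limsup`. -/
structure PortmanteauBounds (ν : ℕ → Measure (EuclideanSpace ℝ (Fin d)))
    (μ : Measure (EuclideanSpace ℝ (Fin d))) : Prop where
  eventually_lt_of_isOpen : ∀ G, IsOpen G → ∀ c, c < μ.real G → ∀ᶠ n in atTop, c < (ν n).real G
  eventually_lt_of_isClosed : ∀ F, IsClosed F → ∀ c, μ.real F < c → ∀ᶠ n in atTop, (ν n).real F < c

lemma PortmanteauBounds.const (μ : Measure (EuclideanSpace ℝ (Fin d))) :
    PortmanteauBounds (fun _ => μ) μ :=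
  ⟨fun _ _ _ h => Eventually.of_forall fun _ => h, fun _ _ _ h => Eventually.of_forall fun _ => h⟩

/-- By complementation, the bound for closed sets follows from the one for open sets if no `ν n` has
larger total mass than `μ`. -/
lemma portmanteauBounds_of_isOpen {ν : ℕ → Measure (EuclideanSpace ℝ (Fin d))}
    {μ : Measure (EuclideanSpace ℝ (Fin d))} [IsFiniteMeasure μ] [∀ n, IsFiniteMeasure (ν n)]
    (hopen : ∀ G, IsOpen G → ∀ c, c < μ.real G → ∀ᶠ n in atTop, c < (ν n).real G)
    (huniv : ∀ n, (ν n).real Set.univ ≤ μ.real Set.univ) : PortmanteauBounds ν μ := by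
  refine ⟨hopen, fun F hF c hc => ?_⟩
  have h1 := measureReal_compl (μ := μ) hF.measurableSet
  filter_upwards [hopen Fᶜ hF.isOpen_compl (μ.real Set.univ - c) (by linarith)] with n hn
  have h2 := measureReal_compl (μ := ν n) hF.measurableSet
  linarith [huniv n]

lemma portmanteauBounds_of_tendsto {μs : ℕ → FiniteMeasure (EuclideanSpace ℝ (Fin d))}
    {μ : FiniteMeasure (EuclideanSpace ℝ (Fin d))} (h : Tendsto μs atTop (𝓝 μ)) :
    PortmanteauBounds (fun n => (μs n : Measure (EuclideanSpace ℝ (Fin d))))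
      (μ : Measure (EuclideanSpace ℝ (Fin d))) := by
  have hclosed : ∀ F, IsClosed F → ∀ c, (μ : Measure (EuclideanSpace ℝ (Fin d))).real F < c →
      ∀ᶠ n in atTop, (μs n : Measure (EuclideanSpace ℝ (Fin d))).real F < c := by
    intro F hF c hc
    have hlim := FiniteMeasure.limsup_measure_closed_le_of_tendsto h hF
    have hc' : (μ : Measure (EuclideanSpace ℝ (Fin d))) F < ENNReal.ofReal c :=
      (ENNReal.lt_ofReal_iff_toReal_lt (measure_ne_top _ _)).2 hc
    filter_upwards [eventually_lt_of_limsup_lt (hlim.trans_lt hc')] with n hn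
    exact (ENNReal.lt_ofReal_iff_toReal_lt (measure_ne_top _ _)).1 hn
  refine ⟨fun G hG c hc => ?_, hclosed⟩
  have hmass : Tendsto (fun n => (μs n : Measure (EuclideanSpace ℝ (Fin d))).real Set.univ) atTop
      (𝓝 ((μ : Measure (EuclideanSpace ℝ (Fin d))).real Set.univ)) :=
    (NNReal.continuous_coe.tendsto _).comp h.mass
  have h1 := measureReal_compl (μ := (μ : Measure (EuclideanSpace ℝ (Fin d)))) hG.measurableSet
  set e := (μ : Measure (EuclideanSpace ℝ (Fin d))).real G - c with he
  filter_upwards [hclosed Gᶜ hG.isClosed_compl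
      ((μ : Measure (EuclideanSpace ℝ (Fin d))).real Set.univ - c - e / 2) (by linarith),
    hmass.eventually (lt_mem_nhds (show
      (μ : Measure (EuclideanSpace ℝ (Fin d))).real Set.univ - e / 2 < _ by linarith))] with n h2 h3
  have h4 := measureReal_compl (μ := (μs n : Measure (EuclideanSpace ℝ (Fin d)))) hG.measurableSet
  linarith

/-! ### Semicontinuity of the depth along the sequence -/

section Semicontinuity

variable {μ : Measure (EuclideanSpace ℝ (Fin d))} [IsFiniteMeasure μ]
  {ν : ℕ → Measure (EuclideanSpace ℝ (Fin d))} [∀ n, IsFiniteMeasure (ν n)]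

/-- Lower semicontinuity at a fixed point `y`, uniformly over all directions. -/
theorem eventually_le_depth [NeZero d] (hν : PortmanteauBounds ν μ)
    {y : EuclideanSpace ℝ (Fin d)} {α : ℝ}
    (h : ∀ u : EuclideanSpace ℝ (Fin d), ‖u‖ = 1 → α < μ.real (openHalfspace y u)) :
    ∀ᶠ p : ℕ × ℝ in atTop ×ˢ 𝓝 α, p.2 ≤ depth (ν p.1) y := by
  have key : {q : (ℕ × ℝ) × EuclideanSpace ℝ (Fin d) |
      q.1.2 ≤ (ν q.1.1).real (halfspace y q.2)} ∈
      (atTop ×ˢ 𝓝 α) ×ˢ 𝓝ˢ (Metric.sphere (0 : EuclideanSpace ℝ (Fin d)) 1) := by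
    refine (isCompact_sphere _ _).mem_prod_nhdsSet_of_forall fun u hu => ?_
    have hu1 : ‖u‖ = 1 := by simpa using hu
    -- `G k` exhausts the open halfspace at `y` with normal `u` by open sets that stay inside the
    -- halfspaces at `y` with normals close to `u`.
    set G : ℕ → Set (EuclideanSpace ℝ (Fin d)) := fun k =>
      {z | 1 / ((k : ℝ) + 1) < inner ℝ (z - y) u ∧ ‖z - y‖ < (k : ℝ) + 1} with hG
    have hGo : ∀ k, IsOpen (G k) := fun k => by
      have h1 : Continuous fun z : EuclideanSpace ℝ (Fin d) => inner ℝ (z - y) u := by fun_prop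
      have h2 : Continuous fun z : EuclideanSpace ℝ (Fin d) => ‖z - y‖ := by fun_prop
      exact (isOpen_lt continuous_const h1).inter (isOpen_lt h2 continuous_const)
    have hGm : Monotone G := by
      intro i j hij z hz
      have hij' : (i : ℝ) ≤ j := by exact_mod_cast hij
      refine ⟨lt_of_le_of_lt ?_ hz.1, hz.2.trans_le (by linarith)⟩
      exact one_div_le_one_div_of_le (by positivity) (by linarith)
    have hGU : ⋃ k, G k = openHalfspace y u := by
      ext z
      simp only [hG, Set.mem_iUnion, Set.mem_ofPred_eq, openHalfspace]
      constructor
      · rintro ⟨k, hk, -⟩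
        have : (0 : ℝ) < 1 / ((k : ℝ) + 1) := by positivity
        rw [inner_sub_left] at hk
        linarith
      · intro hz
        have hz' : 0 < inner ℝ (z - y) u := by rw [inner_sub_left]; linarith
        obtain ⟨i, hi⟩ := exists_nat_one_div_lt hz'
        obtain ⟨j, hj⟩ := exists_nat_gt ‖z - y‖
        have hki : (i : ℝ) ≤ (max i j : ℕ) := by exact_mod_cast le_max_left i j
        have hkj : (j : ℝ) ≤ (max i j : ℕ) := by exact_mod_cast le_max_right i j
        refine ⟨max i j, lt_of_le_of_lt ?_ hi, by linarith⟩
        exact one_div_le_one_div_of_le (by positivity) (by linarith)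
    have hlim : Tendsto (fun k => μ.real (G k)) atTop (𝓝 (μ.real (openHalfspace y u))) := by
      rw [← hGU]
      exact (ENNReal.tendsto_toReal (measure_ne_top _ _)).comp (tendsto_measure_iUnion_atTop hGm)
    obtain ⟨c, hc1, hc2⟩ := exists_between (h u hu1)
    obtain ⟨k, hk⟩ := (hlim.eventually (lt_mem_nhds hc2)).exists
    have hn := hν.eventually_lt_of_isOpen (G k) (hGo k) c hk
    have hr : (0 : ℝ) < 1 / ((k : ℝ) + 1) ^ 2 := by positivity
    filter_upwards [(hn.prod_mk (gt_mem_nhds hc1)).prod_mk (Metric.ball_mem_nhds u hr)]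
      with ⟨⟨n, α'⟩, u'⟩ ⟨⟨h1, h2⟩, h3⟩
    refine h2.le.trans (h1.le.trans (measureReal_mono fun z hz => ?_))
    have h4 : |inner ℝ (z - y) (u' - u)| ≤ ‖z - y‖ * ‖u' - u‖ := abs_real_inner_le_norm _ _
    have h5 : ‖u' - u‖ < 1 / ((k : ℝ) + 1) ^ 2 := by simpa [dist_eq_norm] using h3
    have h6 : ‖z - y‖ * ‖u' - u‖ ≤ ((k : ℝ) + 1) * (1 / ((k : ℝ) + 1) ^ 2) :=
      mul_le_mul hz.2.le h5.le (norm_nonneg _) (by positivity)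
    have h7 : ((k : ℝ) + 1) * (1 / ((k : ℝ) + 1) ^ 2) = 1 / ((k : ℝ) + 1) := by
      field_simp
    have h8 : inner ℝ (z - y) u' = inner ℝ (z - y) u + inner ℝ (z - y) (u' - u) := by
      rw [← inner_add_right]; congr 1; abel
    have h9 := neg_abs_le (inner ℝ (z - y) (u' - u))
    have h10 : 0 ≤ inner ℝ (z - y) u' := by linarith [hz.1]
    rw [inner_sub_left] at h10
    simp only [halfspace, Set.mem_ofPred_eq]
    linarith
  have key' := (Filter.eventually_iff.2 key).curry
  filter_upwards [key'] with p hp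
  exact le_depth fun u hu => hp.self_of_nhdsSet u (by simpa using hu)

/-- Upper semicontinuity jointly in the point, the level and the index. -/
theorem eventually_depth_lt [NeZero d] (hν : PortmanteauBounds ν μ)
    {x : EuclideanSpace ℝ (Fin d)} {α : ℝ} (h : depth μ x < α) :
    ∀ᶠ p : ℕ × (EuclideanSpace ℝ (Fin d) × ℝ) in atTop ×ˢ 𝓝 (x, α),
      depth (ν p.1) p.2.1 < p.2.2 := by
  obtain ⟨u, hu, hxu⟩ := exists_measureReal_halfspace_lt h
  obtain ⟨c, hc1, hc2⟩ := exists_between hxu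
  -- The halfspaces with normal `u` bounded at `x - u / (k + 1)` decrease to the one bounded at `x`.
  set F : ℕ → Set (EuclideanSpace ℝ (Fin d)) := fun k =>
    {z | inner ℝ x u - 1 / ((k : ℝ) + 1) ≤ inner ℝ z u} with hF
  have hFc : ∀ k, IsClosed (F k) := fun k => isClosed_le (by fun_prop) (by fun_prop)
  have hFa : Antitone F := by
    intro i j hij z hz
    have hij' : (i : ℝ) ≤ j := by exact_mod_cast hij
    have : 1 / ((j : ℝ) + 1) ≤ 1 / ((i : ℝ) + 1) :=
      one_div_le_one_div_of_le (by positivity) (by linarith)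
    simp only [hF, Set.mem_ofPred_eq] at hz ⊢
    linarith
  have hFI : ⋂ k, F k = halfspace x u := by
    ext z
    simp only [hF, Set.mem_iInter, Set.mem_ofPred_eq, halfspace]
    constructor
    · intro hz
      refine le_of_forall_pos_lt_add fun e he => ?_
      obtain ⟨k, hk⟩ := exists_nat_one_div_lt he
      linarith [hz k]
    · intro hz k
      have : (0 : ℝ) < 1 / ((k : ℝ) + 1) := by positivity
      linarith
  have hlim : Tendsto (fun k => μ.real (F k)) atTop (𝓝 (μ.real (halfspace x u))) := by
    rw [← hFI]
    exact (ENNReal.tendsto_toReal (measure_ne_top _ _)).comp (tendsto_measure_iInter_atTop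
      (fun k => (hFc k).measurableSet.nullMeasurableSet) hFa ⟨0, measure_ne_top _ _⟩)
  obtain ⟨k, hk⟩ := (hlim.eventually (gt_mem_nhds hc1)).exists
  have hn := hν.eventually_lt_of_isClosed (F k) (hFc k) c hk
  have hr : (0 : ℝ) < 1 / ((k : ℝ) + 1) := by positivity
  have hx : ∀ᶠ x' in 𝓝 x, inner ℝ x u - 1 / ((k : ℝ) + 1) < inner ℝ x' u := by
    have hcont : Continuous fun x' : EuclideanSpace ℝ (Fin d) => inner ℝ x' u := by fun_prop
    exact (hcont.tendsto x).eventually (lt_mem_nhds (by linarith))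
  rw [nhds_prod_eq]
  filter_upwards [hn.prod_mk (hx.prod_mk (lt_mem_nhds hc2))] with ⟨n, x', α'⟩ ⟨h1, h2, h3⟩
  refine (depth_le _ _ hu).trans_lt (lt_of_le_of_lt (measureReal_mono fun z hz => ?_) (h1.trans h3))
  exact h2.le.trans hz

/-- Tightness: the regions of a positive level are eventually contained in a common ball. -/
theorem exists_radius (hν : PortmanteauBounds ν μ) {a : ℝ} (ha : 0 < a) :
    ∃ R : ℝ, ∀ᶠ n in atTop, ∀ x, a ≤ depth (ν n) x → ‖x‖ ≤ R := by
  set F : ℕ → Set (EuclideanSpace ℝ (Fin d)) := fun k => {z | (k : ℝ) + 1 ≤ ‖z‖} with hF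
  have hFc : ∀ k, IsClosed (F k) := fun k => isClosed_le (by fun_prop) (by fun_prop)
  have hFa : Antitone F := by
    intro i j hij z hz
    have hij' : (i : ℝ) ≤ j := by exact_mod_cast hij
    simp only [hF, Set.mem_ofPred_eq] at hz ⊢
    linarith
  have hFI : ⋂ k, F k = ∅ := by
    ext z
    simp only [hF, Set.mem_iInter, Set.mem_ofPred_eq, Set.mem_empty_iff_false, iff_false, not_forall,
      not_le]
    obtain ⟨k, hk⟩ := exists_nat_gt ‖z‖
    exact ⟨k, by linarith⟩
  have hlim : Tendsto (fun k => μ.real (F k)) atTop (𝓝 (μ.real ∅)) := by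
    rw [← hFI]
    exact (ENNReal.tendsto_toReal (measure_ne_top _ _)).comp (tendsto_measure_iInter_atTop
      (fun k => (hFc k).measurableSet.nullMeasurableSet) hFa ⟨0, measure_ne_top _ _⟩)
  rw [measureReal_empty] at hlim
  obtain ⟨k, hk⟩ := (hlim.eventually (gt_mem_nhds ha)).exists
  refine ⟨k + 1, ?_⟩
  filter_upwards [hν.eventually_lt_of_isClosed (F k) (hFc k) a hk] with n hn x hx
  by_contra! hxk
  have hx0 : 0 < ‖x‖ := lt_trans (by positivity) hxk
  have hu : ‖(‖x‖⁻¹ • x : EuclideanSpace ℝ (Fin d))‖ = 1 := by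
    rw [norm_smul, norm_inv, norm_norm, inv_mul_cancel₀ hx0.ne']
  refine absurd (hx.trans (depth_le _ _ hu)) (not_le.2 (lt_of_le_of_lt (measureReal_mono ?_) hn))
  intro z hz
  have h1 : inner ℝ x (‖x‖⁻¹ • x) = ‖x‖ := by
    rw [inner_smul_right, real_inner_self_eq_norm_sq]; field_simp
  have h2 : inner ℝ z (‖x‖⁻¹ • x) ≤ ‖z‖ := by
    simpa [hu] using real_inner_le_norm z (‖x‖⁻¹ • x)
  simp only [halfspace, Set.mem_ofPred_eq, h1] at hz
  simp only [hF, Set.mem_ofPred_eq]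
  linarith

/-! ### Convergence of the depth regions -/

/-- For two sequences with the same limit, the regions of the first are eventually contained in the
`ε`-neighbourhoods of the regions of the second, uniformly over the levels in `[a, b]`. -/
theorem eventually_forall_exists_dist_le [NeZero d]
    {ν' : ℕ → Measure (EuclideanSpace ℝ (Fin d))} [∀ n, IsFiniteMeasure (ν' n)]
    (hμ : HasContiguousSupport μ) {m : EuclideanSpace ℝ (Fin d)} (hm : IsSmoothAt μ m)
    {a b : ℝ} (ha : 0 < a) (hb : b < depth μ m)
    (hν : PortmanteauBounds ν μ) (hν' : PortmanteauBounds ν' μ) {ε : ℝ} (hε : 0 < ε) :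
    ∀ᶠ n in atTop, ∀ α ∈ Set.Icc a b, ∀ x ∈ depthRegion (ν n) α,
      ∃ y ∈ depthRegion (ν' n) α, dist x y ≤ ε := by
  obtain ⟨R, hR⟩ := exists_radius hν ha
  have hK : IsCompact (Metric.closedBall (0 : EuclideanSpace ℝ (Fin d)) R ×ˢ Set.Icc a b) :=
    (isCompact_closedBall _ _).prod isCompact_Icc
  have key : {q : ℕ × (EuclideanSpace ℝ (Fin d) × ℝ) | q.2.1 ∈ depthRegion (ν q.1) q.2.2 →
      ∃ y ∈ depthRegion (ν' q.1) q.2.2, dist q.2.1 y ≤ ε} ∈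
      atTop ×ˢ 𝓝ˢ (Metric.closedBall (0 : EuclideanSpace ℝ (Fin d)) R ×ˢ Set.Icc a b) := by
    refine hK.mem_prod_nhdsSet_of_forall ?_
    rintro ⟨x, α⟩ ⟨-, hα⟩
    rcases lt_or_ge (depth μ x) α with hx | hx
    · filter_upwards [eventually_depth_lt hν hx] with q hq hq'
      exact absurd hq' (not_le.2 hq)
    · -- A point of the segment from `x` to `m` close to `x` serves for all nearby points and levels.
      obtain ⟨t, ht0, ht1, ht⟩ : ∃ t : ℝ, 0 < t ∧ t < 1 ∧ t * ‖m - x‖ < ε / 2 := by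
        have h1 : Tendsto (fun t : ℝ => t * ‖m - x‖) (𝓝[>] 0) (𝓝 0) := by
          have : Continuous fun t : ℝ => t * ‖m - x‖ := by fun_prop
          simpa using (this.tendsto 0).mono_left nhdsWithin_le_nhds
        obtain ⟨t, h2, h3⟩ := ((h1.eventually (gt_mem_nhds (half_pos hε))).and
          (Ioo_mem_nhdsGT (zero_lt_one (α := ℝ)))).exists
        exact ⟨t, h3.1, h3.2, h2⟩
      have hy := eventually_le_depth hν' (y := x + t • (m - x)) (α := α) fun u hu =>
        lt_measureReal_openHalfspace hμ hm (ha.trans_le hα.1) hx (hα.2.trans_lt hb) ht0 ht1 hu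
      have h1 : Tendsto (fun q : ℕ × (EuclideanSpace ℝ (Fin d) × ℝ) => (q.1, q.2.2))
          (atTop ×ˢ 𝓝 (x, α)) (atTop ×ˢ 𝓝 α) :=
        tendsto_fst.prodMk ((continuous_snd.tendsto (x, α)).comp tendsto_snd)
      have h2 : Tendsto (fun q : ℕ × (EuclideanSpace ℝ (Fin d) × ℝ) => q.2.1)
          (atTop ×ˢ 𝓝 (x, α)) (𝓝 x) :=
        (continuous_fst.tendsto (x, α)).comp tendsto_snd
      filter_upwards [h1.eventually hy, h2.eventually (Metric.ball_mem_nhds x (half_pos hε))]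
        with q hq1 hq2 _
      refine ⟨_, hq1, (dist_triangle _ x _).trans ?_⟩
      have h3 : dist x (x + t • (m - x)) = t * ‖m - x‖ := by
        rw [dist_self_add_right, norm_smul, Real.norm_of_nonneg ht0.le]
      have h4 : dist q.2.1 x < ε / 2 := hq2
      linarith
  filter_upwards [(Filter.eventually_iff.2 key).curry, hR] with n hn hRn α hα x hx
  exact hn.self_of_nhdsSet (x, α)
    ⟨by simpa using hRn x (hα.1.trans hx), hα⟩ hx

/-- Uniform convergence of the depth regions under weak convergence; smoothness is needed only at
one point `m` that is deeper than all levels considered. -/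
theorem tendsto_supHausdorffDist [NeZero d] (hμ : HasContiguousSupport μ)
    {m : EuclideanSpace ℝ (Fin d)} (hm : IsSmoothAt μ m) {a b : ℝ} (ha : 0 < a)
    (hb : b < depth μ m) (hν : PortmanteauBounds ν μ) :
    Tendsto (fun n => supHausdorffDist (ν n) μ (Set.Icc a b)) atTop (𝓝 0) := by
  rw [ENNReal.tendsto_nhds_zero]
  intro e he
  obtain ⟨ε, hε, hεe⟩ : ∃ ε : ℝ, 0 < ε ∧ ENNReal.ofReal ε ≤ e := by
    rcases eq_or_ne e ⊤ with rfl | h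
    · exact ⟨1, one_pos, le_top⟩
    · exact ⟨e.toReal, ENNReal.toReal_pos he.ne' h, ENNReal.ofReal_toReal_le⟩
  filter_upwards [eventually_forall_exists_dist_le hμ hm ha hb hν (.const μ) hε,
    eventually_forall_exists_dist_le hμ hm ha hb (.const μ) hν hε] with n h1 h2
  refine iSup₂_le fun α hα => (Metric.hausdorffEDist_le_of_mem_edist ?_ ?_).trans hεe
  · intro x hx
    obtain ⟨y, hy, hxy⟩ := h1 α hα x hx
    exact ⟨y, hy, by rw [edist_dist]; exact ENNReal.ofReal_le_ofReal hxy⟩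
  · intro x hx
    obtain ⟨y, hy, hxy⟩ := h2 α hα x hx
    exact ⟨y, hy, by rw [edist_dist]; exact ENNReal.ofReal_le_ofReal hxy⟩

end Semicontinuity

/-! ### Empirical measures -/

lemma empiricalMeasure_real (x : ℕ → EuclideanSpace ℝ (Fin d)) (n : ℕ)
    {B : Set (EuclideanSpace ℝ (Fin d))} (hB : MeasurableSet B) :
    (empiricalMeasure x n).real B =
      (∑ i ∈ Finset.range n, B.indicator (fun _ => (1 : ℝ)) (x i)) / n := by
  rw [empiricalMeasure, measureReal_ennreal_smul_apply, measureReal_def,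
    Measure.finsetSum_apply _ _ _, ENNReal.toReal_sum (fun i _ => measure_ne_top _ _), div_eq_inv_mul]
  congr 1
  · simp
  · refine Finset.sum_congr rfl fun i _ => ?_
    rw [Measure.dirac_apply' _ hB]
    by_cases h : x i ∈ B <;> simp [h]

lemma empiricalMeasure_univ_le (x : ℕ → EuclideanSpace ℝ (Fin d)) (n : ℕ) :
    empiricalMeasure x n Set.univ ≤ 1 := by
  simp only [empiricalMeasure, Measure.smul_apply, Measure.finsetSum_apply, measure_univ,
    Finset.sum_const, Finset.card_range, nsmul_eq_mul, mul_one, smul_eq_mul]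
  exact ENNReal.inv_mul_le_one _

instance (x : ℕ → EuclideanSpace ℝ (Fin d)) (n : ℕ) : IsFiniteMeasure (empiricalMeasure x n) :=
  ⟨(empiricalMeasure_univ_le x n).trans_lt ENNReal.one_lt_top⟩

/-- Almost surely, the empirical measures converge weakly to the sampling distribution: the strong
law of large numbers applies to the countably many finite unions of sets of a countable basis, and
these approximate every open set from inside. -/
theorem ae_portmanteauBounds_empiricalMeasure {μ : Measure (EuclideanSpace ℝ (Fin d))}
    [IsProbabilityMeasure μ] {Ω : Type*} [MeasurableSpace Ω] {P : Measure Ω}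
    [IsProbabilityMeasure P] {X : ℕ → Ω → EuclideanSpace ℝ (Fin d)} (hX : ∀ i, Measurable (X i))
    (hindep : ProbabilityTheory.iIndepFun X P) (hlaw : ∀ i, P.map (X i) = μ) :
    ∀ᵐ ω ∂P, PortmanteauBounds (empiricalMeasure fun i => X i ω) μ := by
  have slln : ∀ B : Set (EuclideanSpace ℝ (Fin d)), MeasurableSet B →
      ∀ᵐ ω ∂P, Tendsto (fun n => (empiricalMeasure (fun i => X i ω) n).real B) atTop
        (𝓝 (μ.real B)) := by
    intro B hB
    have hf : Measurable (B.indicator fun _ => (1 : ℝ)) := measurable_const.indicator hB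
    have hid : ∀ i, ProbabilityTheory.IdentDistrib (X i) (X 0) P P := fun i =>
      ⟨(hX i).aemeasurable, (hX 0).aemeasurable, by rw [hlaw, hlaw]⟩
    have h := ProbabilityTheory.strong_law_ae_real (μ := P)
      (fun i ω => B.indicator (fun _ => (1 : ℝ)) (X i ω))
      ((integrable_const (1 : ℝ)).indicator ((hX 0) hB))
      (fun i j hij => (hindep.indepFun hij).comp hf hf) (fun i => (hid i).comp hf)
    have hint : ∫ ω, B.indicator (fun _ => (1 : ℝ)) (X 0 ω) ∂P = μ.real B := by
      rw [← integral_map (hX 0).aemeasurable hf.aestronglyMeasurable, hlaw,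
        integral_indicator_const _ hB]
      simp
    rw [hint] at h
    filter_upwards [h] with ω hω
    simpa only [empiricalMeasure_real _ _ hB] using hω
  obtain ⟨S, hS⟩ := (TopologicalSpace.countable_countableBasis
    (EuclideanSpace ℝ (Fin d))).exists_eq_range (by
      obtain ⟨B, hB, -⟩ := (TopologicalSpace.isBasis_countableBasis
        (EuclideanSpace ℝ (Fin d))).exists_subset_of_mem_open (Set.mem_univ 0) isOpen_univ
      exact ⟨B, hB⟩)
  have hSb : TopologicalSpace.IsTopologicalBasis (Set.range S) :=
    hS ▸ TopologicalSpace.isBasis_countableBasis _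
  have hSo : ∀ i, IsOpen (S i) := fun i => hSb.isOpen ⟨i, rfl⟩
  have hall : ∀ᵐ ω ∂P, ∀ s : Finset ℕ,
      Tendsto (fun n => (empiricalMeasure (fun i => X i ω) n).real (⋃ i ∈ s, S i)) atTop
        (𝓝 (μ.real (⋃ i ∈ s, S i))) :=
    ae_all_iff.2 fun s => slln _ (isOpen_biUnion fun i _ => hSo i).measurableSet
  filter_upwards [hall] with ω hω
  refine portmanteauBounds_of_isOpen (fun G hG c hc => ?_) fun n => ?_
  · classical
    set U : ℕ → Set (EuclideanSpace ℝ (Fin d)) := fun k =>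
      ⋃ i ∈ (Finset.range k).filter (fun i => S i ⊆ G), S i with hU
    have hUm : Monotone U := fun j k hjk =>
      Set.biUnion_subset_biUnion_left fun i hi => by
        simp only [Finset.coe_filter, Finset.mem_range] at hi ⊢
        exact ⟨hi.1.trans_le hjk, hi.2⟩
    have hUG : ∀ k, U k ⊆ G := fun k => Set.iUnion₂_subset fun i hi => (Finset.mem_filter.1 hi).2
    have hUU : ⋃ k, U k = G := by
      refine (Set.iUnion_subset hUG).antisymm fun z hz => ?_
      obtain ⟨_, ⟨i, rfl⟩, hzi, hiG⟩ := hSb.exists_subset_of_mem_open hz hG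
      exact Set.mem_iUnion.2 ⟨i + 1, Set.mem_biUnion
        (Finset.mem_coe.2 (Finset.mem_filter.2 ⟨Finset.mem_range.2 i.lt_succ_self, hiG⟩)) hzi⟩
    have hlim : Tendsto (fun k => μ.real (U k)) atTop (𝓝 (μ.real G)) := by
      rw [← hUU]
      exact (ENNReal.tendsto_toReal (measure_ne_top _ _)).comp (tendsto_measure_iUnion_atTop hUm)
    obtain ⟨k, hk⟩ := (hlim.eventually (lt_mem_nhds hc)).exists
    filter_upwards [(hω _).eventually (lt_mem_nhds hk)] with n hn
    exact hn.trans_le (measureReal_mono (hUG k))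
  · rw [probReal_univ (μ := μ)]
    refine ENNReal.toReal_le_of_le_ofReal zero_le_one ?_
    simpa using empiricalMeasure_univ_le (fun i => X i ω) n

end HalfspaceDepth

theorem corollary4 (d : ℕ) (hd : 1 ≤ d) :
    (∀ (μ : Measure (EuclideanSpace ℝ (Fin d))) [IsProbabilityMeasure μ],
      HalfspaceDepth.HasContiguousSupport μ →
      (∃ x ∈ HalfspaceDepth.medianSet μ, HalfspaceDepth.IsSmoothAt μ x) →
      ∀ (Ω : Type*) [MeasurableSpace Ω] (P : Measure Ω) [IsProbabilityMeasure P]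
        (X : ℕ → Ω → EuclideanSpace ℝ (Fin d)),
        (∀ i, Measurable (X i)) →
        ProbabilityTheory.iIndepFun X P →
        (∀ i, P.map (X i) = μ) →
        ∀ a b : ℝ, Set.Icc a b ⊆ Set.Ioo 0 (HalfspaceDepth.maxDepth μ) →
          ∀ᵐ ω ∂P, Tendsto
            (fun n : ℕ => HalfspaceDepth.supHausdorffDist
              (HalfspaceDepth.empiricalMeasure (fun i => X i ω) n) μ (Set.Icc a b))
            atTop (𝓝 0)) ∧
    (∀ μ : FiniteMeasure (EuclideanSpace ℝ (Fin d)),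
      HalfspaceDepth.IsSmooth (μ : Measure (EuclideanSpace ℝ (Fin d))) →
      HalfspaceDepth.HasContiguousSupport (μ : Measure (EuclideanSpace ℝ (Fin d))) →
      ∀ a b : ℝ, Set.Icc a b ⊆ Set.Ioo 0
          (HalfspaceDepth.maxDepth (μ : Measure (EuclideanSpace ℝ (Fin d)))) →
        ∀ μs : ℕ → FiniteMeasure (EuclideanSpace ℝ (Fin d)),
          Tendsto μs atTop (𝓝 μ) →
          Tendsto
            (fun n : ℕ => HalfspaceDepth.supHausdorffDist
              (μs n : Measure (EuclideanSpace ℝ (Fin d)))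
              (μ : Measure (EuclideanSpace ℝ (Fin d))) (Set.Icc a b))
            atTop (𝓝 0)) := by
  have : NeZero d := ⟨by omega⟩
  refine ⟨?_, ?_⟩
  · intro μ _ hμ ⟨m, hmed, hm⟩ Ω _ P _ X hX hindep hlaw a b hab
    filter_upwards [HalfspaceDepth.ae_portmanteauBounds_empiricalMeasure hX hindep hlaw] with ω hω
    rcases lt_or_ge b a with hba | hba
    · simp [HalfspaceDepth.supHausdorffDist, Set.Icc_eq_empty (not_le.2 hba)]
    · exact HalfspaceDepth.tendsto_supHausdorffDist hμ hm (hab ⟨le_rfl, hba⟩).1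
        ((hab ⟨hba, le_rfl⟩).2.trans_le hmed) hω
  · intro μ hsm hμ a b hab μs hμs
    rcases lt_or_ge b a with hba | hba
    · simp [HalfspaceDepth.supHausdorffDist, Set.Icc_eq_empty (not_le.2 hba)]
    · obtain ⟨m, hbm⟩ := HalfspaceDepth.exists_lt_depth_of_lt_maxDepth (hab ⟨hba, le_rfl⟩).2
      exact HalfspaceDepth.tendsto_supHausdorffDist hμ (hsm m) (hab ⟨le_rfl, hba⟩).1 hbm
        (HalfspaceDepth.portmanteauBounds_of_tendsto hμs)
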